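/- Let $f:\mathbb{R}\to\mathbb{R}$ be Lipschitz and 1-periodic, let $\theta^*\in\mathbb{R}$, and suppose that $f(\cdot-\theta)\neq f(\cdot-\theta^*)$ on a subset of $[0,1]$ of positive Lebesgue measure whenever $\theta\neq\theta^* \bmod 1$. Let $Z_1,Z_2,\dots$ be iid real random variables with an even density $\phi$ and distribution function $\Phi$, put $x_i=i/n$, and for $n\ge 1$ observe $$Y_i=f(x_i-\theta^*)+Z_i,\qquad i=1,\dots,n.$$ Let $R_i=\#\{j\in\{1,\dots,n\}:Y_j\le Y_i\}$ be the rank of $Y_i$ in $\{Y_1,\dots,Y_n\}$, and set $$\widehat M_n(\theta)=\frac1n\sum_{i=1}^n\frac{R_i}{n}f(x_i-\theta),\qquad M(\theta)=\int_0^1\!\int_0^1\Phi_2\big(f(x_0)-f(x)\big)\,f(x_0+\theta^*-\theta)\,dx\,dx_0,$$ where $\Phi_2(t)=\int_{-\infty}^{\infty}\Phi(t+z)\phi(z)\,dz$. Assume that $\theta^*$ is, modulo 1, the unique maximum point of $M$: $M(\theta)<M(\theta^*)$ whenever $\theta\neq\theta^*\bmod 1$. Theorem. Let $\hat\theta_n$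 be, for each $n\ge 1$, a maximizer (almost surely) of $\widehat M_n$ over $\mathbb{R}$. Then $\hat\theta_n$ is $\sqrt n$-consistent for $\theta^*$, the shift being understood modulo 1: the sequence $\sqrt n\,\min_{k\in\mathbb{Z}}|\hat\theta_n-\theta^*-k|$ is bounded in probability, that is, for every $\varepsilon>0$ there is $K$ such that $$\mathbb{P}\Big(\sqrt n\,\min_{k\in\mathbb{Z}}|\hat\theta_n-\theta^*-k|>K\Big)\le\varepsilon\quad\text{for all } n\ge 1.$$ In particular, if the representative of $\hat\theta_n$ modulo 1 is chosen with $|\hat\theta_n-\theta^*|\le 1/2$, then $\sqrt n(\hat\theta_n-\theta^*)$ is bounded in probability. -/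

import Mathlib

open MeasureTheory ProbabilityTheory

namespace RankTemplate

/-- `a = b mod 1` for real numbers. -/
def EqModOne (a b : ℝ) : Prop := ∃ k : ℤ, a - b = k

/-- The shift is a point of the circle `ℝ / ℤ`: this is the distance there between the classes of
`a` and `b`, i.e. the distance from `a - b` to the nearest integer. -/
noncomputable def circleDist (a b : ℝ) : ℝ := ‖((a - b : ℝ) : UnitAddCircle)‖

/-- The observation `Y_i = f (x_i - θ*) + Z_i` at the design point `x_i = i / n`
(for `i = 1, …, n`), for a realization `z` of the noise. -/
noncomputable def observation (f : ℝ → ℝ) (θstar : ℝ) (n : ℕ) (z : ℕ → ℝ) (i : ℕ) : ℝ :=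
  f ((i : ℝ) / n - θstar) + z i

open Classical in
/-- The rank of `y i` among `y 1, …, y n` in increasing order. -/
noncomputable def rank (n : ℕ) (y : ℕ → ℝ) (i : ℕ) : ℕ :=
  ((Finset.Icc 1 n).filter (fun j => y j ≤ y i)).card

/-- The rank objective `(1 / n) ∑_{i=1}^n (R_i / n) f (x_i - θ)` computed from `y 1, …, y n`. -/
noncomputable def empiricalM (f : ℝ → ℝ) (n : ℕ) (y : ℕ → ℝ) (θ : ℝ) : ℝ :=
  (1 / (n : ℝ)) * ∑ i ∈ Finset.Icc 1 n, ((rank n y i : ℝ) / n) * f ((i : ℝ) / n - θ)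

/-- The distribution function `Φ` of the density `φ`. -/
noncomputable def distFun (φ : ℝ → ℝ) (t : ℝ) : ℝ := ∫ z in Set.Iic t, φ z

/-- `Φ₂ (t) = ∫ Φ (t + z) φ (z) dz`. -/
noncomputable def distFun₂ (φ : ℝ → ℝ) (t : ℝ) : ℝ := ∫ z, distFun φ (t + z) * φ z

/-- The limit objective
`M (θ) = ∫_0^1 ∫_0^1 Φ₂ (f (x₀) - f (x)) f (x₀ + θ* - θ) dx dx₀`. -/
noncomputable def limitM (f φ : ℝ → ℝ) (θstar θ : ℝ) : ℝ :=
  ∫ x₀ in (0 : ℝ)..1, ∫ x in (0 : ℝ)..1,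
    distFun₂ φ (f x₀ - f x) * f (x₀ + θstar - θ)

/-- The sequence `X` is bounded in probability. For functions `X n` that are not measurable, `μ`
is the outer measure. -/
def BoundedInProbability {Ω : Type*} [MeasurableSpace Ω] (μ : Measure Ω)
    (X : ℕ → Ω → ℝ) : Prop :=
  ∀ ε : ℝ, 0 < ε → ∃ K : ℝ, ∀ n : ℕ, μ {ω | K < |X n ω|} ≤ ENNReal.ofReal ε

end RankTemplate

namespace RankTemplate

open scoped Pointwise

/-! Write a_i = f(x_i - θ*), let d be the circle distance from θ to θ*, and let q be the
distribution function of the difference of two noises. Expanding ranks into indicators of Y_j ≤ Y_i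
makes the objective a weighted mean, which splits into its expectation and a centred noise part.

Expectation: up to the diagonal, the mean weight at i is G(a_i), where G(u) averages q(u - a_j) over
j. G is monotone, so its primitive Ψ is convex. The means of Ψ(f(x_i - θ)) and Ψ(f(x_i - θ*)) are
Riemann sums of the same integral, so the loss in expectation is a mean Bregman divergence up to
O(1/n). Linear growth of q near 0 makes Ψ strongly convex where needed, and the mean square of f(· -
θ) - f(· - θ*) dominates d². This gives `exists_quadratic_separation`: a loss of at least c₁d² -
C/n.

Noise: f is absolutely continuous, so a noise increment is an integral over s of a weighted mean of
f'(x_i - s), whose first absolute moment is O(1/√n) for each s. One integral against a Cauchy weight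
controls all θ at distance at least b at once (`measure_exists_weightedMean_sub_ge_le`). For b =
K/√n, noise matches half the quadratic loss with probability O(1/K), whereas a maximizer farther
than b would require this. -/

/-! ### Riemann sums and a Bregman inequality -/

/-- Right Riemann sums of a periodic Lipschitz function have error at most `K / n`. -/
theorem abs_riemannSum_sub_integral_le {H : ℝ → ℝ} {K : NNReal} (hper : Function.Periodic H 1)
    (hlip : LipschitzWith K H) {n : ℕ} (hn : n ≠ 0) (t : ℝ) :
    |(1 / (n : ℝ)) * ∑ i ∈ Finset.Icc 1 n, H ((i : ℝ) / n - t) - ∫ x in (0 : ℝ)..1, H x|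
      ≤ K / n := by
  have hn0 : (0 : ℝ) < n := by positivity
  have hc : Continuous fun x => H (x - t) := hlip.continuous.comp (by fun_prop)
  have hshift : ∫ x in (0 : ℝ)..1, H x = ∫ x in (0 : ℝ)..1, H (x - t) := by
    rw [intervalIntegral.integral_comp_sub_right H t]
    have := hper.intervalIntegral_add_eq (-t) 0
    simp only [zero_add] at this
    rw [← this]; congr 1 <;> ring
  have hsum : ∫ x in (0 : ℝ)..1, H (x - t) =
      ∑ i ∈ Finset.range n, ∫ x in ((i : ℕ) : ℝ) / n..((i + 1 : ℕ) : ℝ) / n, H (x - t) := by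
    rw [intervalIntegral.sum_integral_adjacent_intervals (a := fun i : ℕ => (i : ℝ) / n)
      (fun k _ => hc.intervalIntegrable _ _)]
    simp [hn0.ne']
  have hre : ∑ i ∈ Finset.Icc 1 n, H ((i : ℝ) / n - t) =
      ∑ i ∈ Finset.range n, H (((i + 1 : ℕ) : ℝ) / n - t) := by
    rw [Finset.range_eq_Ico, Finset.sum_Ico_add' (fun i : ℕ => H ((i : ℝ) / n - t)) 0 n 1]
    rfl
  rw [hshift, hsum, hre, Finset.mul_sum, ← Finset.sum_sub_distrib]
  refine (Finset.abs_sum_le_sum_abs _ _).trans ?_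
  have hterm : ∀ i ∈ Finset.range n, |1 / (n : ℝ) * H (((i + 1 : ℕ) : ℝ) / n - t) -
      ∫ x in ((i : ℕ) : ℝ) / n..((i + 1 : ℕ) : ℝ) / n, H (x - t)| ≤ K / n * (1 / n) := by
    intro i _
    have hlen : ((i + 1 : ℕ) : ℝ) / n - (i : ℝ) / n = 1 / n := by push_cast; field_simp; ring
    have hle : (i : ℝ) / n ≤ ((i + 1 : ℕ) : ℝ) / n := by
      have : (0 : ℝ) < 1 / n := by positivity
      linarith
    have hconst : 1 / (n : ℝ) * H (((i + 1 : ℕ) : ℝ) / n - t) =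
        ∫ x in ((i : ℕ) : ℝ) / n..((i + 1 : ℕ) : ℝ) / n, H (((i + 1 : ℕ) : ℝ) / n - t) := by
      rw [intervalIntegral.integral_const, hlen, smul_eq_mul]
    rw [hconst, ← intervalIntegral.integral_sub (by simp) (hc.intervalIntegrable _ _),
      ← Real.norm_eq_abs]
    have := intervalIntegral.norm_integral_le_of_norm_le_const (a := (i : ℝ) / n)
      (b := ((i + 1 : ℕ) : ℝ) / n) (C := K / n)
      (f := fun x => H (((i + 1 : ℕ) : ℝ) / n - t) - H (x - t)) (by
        intro x hx
        rw [Set.uIoc_of_le hle] at hx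
        have h := hlip.dist_le_mul (((i + 1 : ℕ) : ℝ) / n - t) (x - t)
        rw [Real.dist_eq, Real.dist_eq] at h
        refine h.trans ?_
        rw [div_eq_mul_one_div (K : ℝ)]
        refine mul_le_mul_of_nonneg_left ?_ K.2
        rw [abs_le]; constructor <;> linarith [hx.1, hx.2])
    rwa [hlen, abs_of_pos (by positivity : (0 : ℝ) < 1 / n)] at this
  refine (Finset.sum_le_sum hterm).trans_eq ?_
  rw [Finset.sum_const, Finset.card_range, nsmul_eq_mul]
  field_simp

/-- A monotone function growing at least linearly around `a` has a primitive that is strongly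
convex at `a`. -/
theorem le_integral_of_linear_growth {G : ℝ → ℝ} (hG : Monotone G) {κ a b : ℝ}
    (h : ∀ s ∈ Set.uIcc a b, κ * (s - a) ^ 2 ≤ (G s - G a) * (s - a)) :
    κ / 2 * (b - a) ^ 2 ≤ (∫ s in a..b, G s) - G a * (b - a) := by
  have hint : ∀ u v : ℝ, IntervalIntegrable G volume u v := fun u v => hG.intervalIntegrable
  have hlin : ∀ u v : ℝ, IntervalIntegrable (fun s => κ * (s - a) + G a) volume u v :=
    fun u v => (by fun_prop : Continuous fun s => κ * (s - a) + G a).intervalIntegrable _ _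
  have hval : ∀ u v : ℝ, ∫ s in u..v, (κ * (s - a) + G a) =
      κ / 2 * ((v - a) ^ 2 - (u - a) ^ 2) + G a * (v - u) := by
    intro u v
    rw [intervalIntegral.integral_add
      ((by fun_prop : Continuous fun s => κ * (s - a)).intervalIntegrable _ _) (by simp),
      intervalIntegral.integral_const_mul, intervalIntegral.integral_comp_sub_right (fun s => s) a,
      integral_id, intervalIntegral.integral_const, smul_eq_mul]
    ring
  rcases le_total a b with hab | hab
  · have := intervalIntegral.integral_mono_on hab (hlin a b) (hint a b) (by
      intro s hs
      rcases hs.1.eq_or_lt with rfl | hlt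
      · simp
      · have h1 := h s (by rwa [Set.uIcc_of_le hab])
        have : κ * (s - a) ≤ G s - G a := by
          by_contra hcon
          push Not at hcon
          nlinarith [mul_lt_mul_of_pos_right hcon (sub_pos.2 hlt)]
        linarith)
    rw [hval] at this
    nlinarith
  · have := intervalIntegral.integral_mono_on hab (hint b a) (hlin b a) (by
      intro s hs
      rcases hs.2.eq_or_lt with rfl | hlt
      · simp
      · have h1 := h s (by rwa [Set.uIcc_of_ge hab])
        have : G s - G a ≤ κ * (s - a) := by
          by_contra hcon
          push Not at hcon
          nlinarith [mul_lt_mul_of_neg_right hcon (sub_neg.2 hlt)]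
        linarith)
    rw [hval] at this
    rw [intervalIntegral.integral_symm]
    nlinarith

/-! ### Mean square increments and design points near a given one -/

/-- Telescope the shift by mt into m shifts by t. Cauchy–Schwarz costs a factor m, and by
periodicity the m steps have equal mean squares. -/
theorem integral_sq_shift_nat_mul_le {f : ℝ → ℝ} (hf : Continuous f)
    (hper : Function.Periodic f 1) (t : ℝ) (m : ℕ) :
    ∫ x in (0 : ℝ)..1, (f (x + m * t) - f x) ^ 2 ≤
      (m : ℝ) ^ 2 * ∫ x in (0 : ℝ)..1, (f (x + t) - f x) ^ 2 := by
  have hshift : ∀ k : ℕ, ∫ x in (0 : ℝ)..1, (f (x + (k + 1 : ℕ) * t) - f (x + k * t)) ^ 2 =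
      ∫ x in (0 : ℝ)..1, (f (x + t) - f x) ^ 2 := by
    intro k
    have hp : Function.Periodic (fun x => (f (x + t) - f x) ^ 2) 1 := by
      intro x
      have h1 := hper (x + t)
      have h2 := hper x
      simp only
      rw [h2, show x + 1 + t = x + t + 1 by ring, h1]
    have h1 := intervalIntegral.integral_comp_add_right (a := 0) (b := 1)
      (fun x => (f (x + t) - f x) ^ 2) (k * t)
    have h2 := hp.intervalIntegral_add_eq (k * t) 0
    simp only [zero_add] at h1 h2
    rw [add_comm (1 : ℝ), h2] at h1
    rw [← h1]
    refine intervalIntegral.integral_congr fun x _ => ?_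
    push_cast
    ring_nf
  have hpt : ∀ x, (f (x + m * t) - f x) ^ 2 ≤
      m * ∑ k ∈ Finset.range m, (f (x + (k + 1 : ℕ) * t) - f (x + k * t)) ^ 2 := by
    intro x
    have := sq_sum_le_card_mul_sum_sq (s := Finset.range m)
      (f := fun k => f (x + (k + 1 : ℕ) * t) - f (x + k * t))
    rw [Finset.sum_range_sub (fun k : ℕ => f (x + k * t))] at this
    simpa using this
  calc ∫ x in (0 : ℝ)..1, (f (x + m * t) - f x) ^ 2
      ≤ ∫ x in (0 : ℝ)..1,
          m * ∑ k ∈ Finset.range m, (f (x + (k + 1 : ℕ) * t) - f (x + k * t)) ^ 2 := by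
        refine intervalIntegral.integral_mono_on zero_le_one ?_ ?_ fun x _ => hpt x <;>
        exact (by fun_prop : Continuous _).intervalIntegrable _ _
    _ = _ := by
        rw [intervalIntegral.integral_const_mul, intervalIntegral.integral_finsetSum
          (fun k _ => (by fun_prop : Continuous _).intervalIntegrable _ _)]
        simp_rw [hshift]
        simp
        ring

/-- The mean square increment of a continuous function without period in `(0, 1)` grows at least
quadratically. -/
theorem exists_sq_le_integral_sq_shift {f : ℝ → ℝ} (hf : Continuous f)
    (hper : Function.Periodic f 1)
    (hpos : ∀ t, 0 < t → t ≤ 1 / 2 → 0 < ∫ x in (0 : ℝ)..1, (f (x + t) - f x) ^ 2) :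
    ∃ c : ℝ, 0 < c ∧ ∀ t, 0 < t → t ≤ 1 / 2 →
      c * t ^ 2 ≤ ∫ x in (0 : ℝ)..1, (f (x + t) - f x) ^ 2 := by
  have hcont : Continuous fun t => ∫ x in (0 : ℝ)..1, (f (x + t) - f x) ^ 2 :=
    intervalIntegral.continuous_parametric_intervalIntegral_of_continuous' (by fun_prop) 0 1
  obtain ⟨t₀, ht₀, hmin⟩ := isCompact_Icc.exists_isMinOn (s := Set.Icc (1 / 4 : ℝ) (1 / 2))
    ⟨1 / 4, by norm_num⟩ hcont.continuousOn
  have hc0 := hpos t₀ (by linarith [ht₀.1]) ht₀.2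
  -- Some multiple mt lies in [1/4, 1/2], where the mean square is at least its minimum A. Hence D ≥
  -- A / m², and mt ≤ 1/2 gives 1 / m² ≥ 4t².
  refine ⟨4 * ∫ x in (0 : ℝ)..1, (f (x + t₀) - f x) ^ 2, by positivity, fun t ht htle => ?_⟩
  obtain ⟨m, hm1, hm2⟩ : ∃ m : ℕ, 1 / 4 ≤ m * t ∧ m * t ≤ 1 / 2 := by
    rcases le_total (1 / 4) t with h | h
    · exact ⟨1, by simpa using h, by simpa using htle⟩
    · refine ⟨⌈1 / (4 * t)⌉₊, ?_, ?_⟩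
      · have := Nat.le_ceil (1 / (4 * t))
        have h2 := mul_le_mul_of_nonneg_right this ht.le
        have : 1 / (4 * t) * t = 1 / 4 := by field_simp
        linarith
      · have := Nat.ceil_lt_add_one (a := 1 / (4 * t)) (by positivity)
        have h2 := mul_le_mul_of_nonneg_right this.le ht.le
        have : (1 / (4 * t) + 1) * t = 1 / 4 + t := by field_simp
        linarith
  have h1 : ∫ x in (0 : ℝ)..1, (f (x + t₀) - f x) ^ 2 ≤
      ∫ x in (0 : ℝ)..1, (f (x + m * t) - f x) ^ 2 := hmin ⟨hm1, hm2⟩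
  have h2 := integral_sq_shift_nat_mul_le hf hper t m
  set A := ∫ x in (0 : ℝ)..1, (f (x + t₀) - f x) ^ 2
  set D := ∫ x in (0 : ℝ)..1, (f (x + t) - f x) ^ 2
  have hD : 0 ≤ D := intervalIntegral.integral_nonneg zero_le_one fun x _ => sq_nonneg _
  have h3 : (m * t) ^ 2 * D ≤ (1 / 2) ^ 2 * D :=
    mul_le_mul_of_nonneg_right (pow_le_pow_left₀ (by positivity) hm2 2) hD
  have h4 : A * t ^ 2 ≤ (m : ℝ) ^ 2 * D * t ^ 2 :=
    mul_le_mul_of_nonneg_right (h1.trans h2) (by positivity)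
  nlinarith

/-- A window of k + 1 > nρ consecutive indices containing i fits inside 1, …, n even when i is near
an end, because 2k ≤ n. -/
theorem card_mul_le_card_filter_Icc {n i : ℕ} (hi : i ∈ Finset.Icc 1 n) {ρ : ℝ} (hρ0 : 0 ≤ ρ)
    (hρ : ρ ≤ 1 / 2) :
    (n : ℝ) * ρ ≤ ((Finset.Icc 1 n).filter (fun j : ℕ => |(i : ℝ) / n - (j : ℝ) / n| ≤ ρ)).card := by
  rw [Finset.mem_Icc] at hi
  have hn : (0 : ℝ) < n := by exact_mod_cast (by omega : 0 < n)
  set k := ⌊(n : ℝ) * ρ⌋₊ with hk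
  have hk1 : (k : ℝ) ≤ n * ρ := Nat.floor_le (by positivity)
  have hk2 : (n : ℝ) * ρ < k + 1 := Nat.lt_floor_add_one _
  have hkn : 2 * k ≤ n := by
    have : (2 * k : ℝ) ≤ n := by nlinarith
    exact_mod_cast this
  have key : ∃ l u : ℕ, 1 ≤ l ∧ u ≤ n ∧ l + k = u ∧ l ≤ i ∧ i ≤ u := by
    rcases le_total (i + k) n with h | h
    · exact ⟨i, i + k, hi.1, h, rfl, le_rfl, by omega⟩
    · exact ⟨n - k, n, by omega, le_rfl, by omega, by omega, hi.2⟩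
  obtain ⟨l, u, hl, hu, hlu, hli, hiu⟩ := key
  have hsub : Finset.Icc l u ⊆
      (Finset.Icc 1 n).filter (fun j : ℕ => |(i : ℝ) / n - (j : ℝ) / n| ≤ ρ) := by
    intro j hj
    rw [Finset.mem_Icc] at hj
    rw [Finset.mem_filter, Finset.mem_Icc]
    refine ⟨⟨by omega, by omega⟩, ?_⟩
    rw [← sub_div, abs_div, abs_of_pos hn, div_le_iff₀ hn]
    have h1 : (i : ℝ) ≤ j + k := by exact_mod_cast (by omega : i ≤ j + k)
    have h2 : (j : ℝ) ≤ i + k := by exact_mod_cast (by omega : j ≤ i + k)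
    rw [abs_le]; constructor <;> linarith
  have := Finset.card_le_card hsub
  rw [Nat.card_Icc] at this
  have h3 : k + 1 ≤ _ := le_trans (by omega) this
  calc (n : ℝ) * ρ ≤ ((k + 1 : ℕ) : ℝ) := by push_cast; exact hk2.le
    _ ≤ _ := by exact_mod_cast h3

/-! ### Law of the difference of two noise variables -/

/-- For independent `z, z'` of law `ν`, the probability that `z' ≤ z + t`. -/
noncomputable def diffDistFun (ν : Measure ℝ) (t : ℝ) : ℝ :=
  (ν.prod ν).real {p : ℝ × ℝ | p.2 ≤ p.1 + t}

theorem measurableSet_snd_le_fst_add (t : ℝ) : MeasurableSet {p : ℝ × ℝ | p.2 ≤ p.1 + t} :=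
  measurableSet_le measurable_snd (by fun_prop)

theorem diffDistFun_monotone (ν : Measure ℝ) [IsProbabilityMeasure ν] :
    Monotone (diffDistFun ν) := by
  intro s t hst
  refine measureReal_mono fun p hp => ?_
  simp only [Set.mem_ofPred_eq] at hp ⊢
  linarith

theorem diffDistFun_nonneg (ν : Measure ℝ) (t : ℝ) : 0 ≤ diffDistFun ν t := measureReal_nonneg

theorem diffDistFun_le_one (ν : Measure ℝ) [IsProbabilityMeasure ν] (t : ℝ) :
    diffDistFun ν t ≤ 1 := measureReal_le_one

/-- Tonelli after substituting y = x + u: the difference has the autocorrelation of φ as density. -/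
theorem lintegral_diff_strip_eq {φ : ℝ → ENNReal} (hφ : Measurable φ) (s t : ℝ) :
    ((volume.withDensity φ).prod (volume.withDensity φ))
      {p : ℝ × ℝ | p.2 - p.1 ∈ Set.Ioc s t} =
      ∫⁻ u in Set.Ioc s t, ∫⁻ x, φ x * φ (x + u) := by
  have hS : MeasurableSet {p : ℝ × ℝ | p.2 - p.1 ∈ Set.Ioc s t} :=
    (by fun_prop : Measurable fun p : ℝ × ℝ => p.2 - p.1) measurableSet_Ioc
  have hm : Measurable fun p : ℝ × ℝ => φ p.1 * φ p.2 := by fun_prop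
  rw [prod_withDensity hφ hφ, withDensity_apply _ hS, ← lintegral_indicator hS,
    lintegral_prod _ (hm.indicator hS).aemeasurable]
  have h1 : ∀ x : ℝ, (∫⁻ y, {p : ℝ × ℝ | p.2 - p.1 ∈ Set.Ioc s t}.indicator
      (fun p => φ p.1 * φ p.2) (x, y)) =
      ∫⁻ u, (Set.Ioc s t).indicator (fun u => φ x * φ (x + u)) u := by
    intro x
    rw [← lintegral_add_left_eq_self _ x]
    refine lintegral_congr fun u => ?_
    have : x + u ≤ t + x ↔ u ≤ t := by constructor <;> intro h <;> linarith
    simp [Set.indicator_apply, this]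
  simp_rw [h1]
  rw [lintegral_lintegral_swap, ← lintegral_indicator measurableSet_Ioc]
  · refine lintegral_congr fun u => ?_
    by_cases hu : u ∈ Set.Ioc s t
    · simp only [Set.indicator_of_mem hu]
    · simp only [Set.indicator_of_notMem hu, lintegral_zero]
  · refine Measurable.aemeasurable ?_
    have : (Function.uncurry fun x u => (Set.Ioc s t).indicator (fun u => φ x * φ (x + u)) u) =
        {p : ℝ × ℝ | p.2 ∈ Set.Ioc s t}.indicator
          (fun p => φ p.1 * φ (p.1 + p.2)) := by
      ext ⟨x, u⟩
      simp [Function.uncurry, Set.indicator_apply]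
    rw [this]
    exact (by fun_prop : Measurable fun p : ℝ × ℝ => φ p.1 * φ (p.1 + p.2)).indicator
      (measurable_snd measurableSet_Ioc)

/-- The autocorrelation of a nonzero density is bounded below near the origin. -/
theorem exists_le_lintegral_mul_shift {φ : ℝ → ENNReal} (hφ : Measurable φ)
    (hne : volume.withDensity φ ≠ 0) :
    ∃ c : ℝ, 0 < c ∧ ∃ r : ℝ, 0 < r ∧ ∀ u, |u| ≤ r →
      ENNReal.ofReal c ≤ ∫⁻ x, φ x * φ (x + u) := by
  obtain ⟨m, hm⟩ : ∃ m : ℕ, 0 < volume {z | ((m : ENNReal) + 1)⁻¹ ≤ φ z} := by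
    by_contra hcon
    push Not at hcon
    apply hne
    rw [withDensity_eq_zero_iff hφ.aemeasurable]
    have : ∀ᵐ z, ∀ m : ℕ, ¬ ((m : ENNReal) + 1)⁻¹ ≤ φ z := by
      rw [ae_all_iff]
      intro m
      rw [ae_iff]
      simpa using hcon m
    filter_upwards [this] with z hz
    by_contra h0
    obtain ⟨k, hk⟩ := ENNReal.exists_inv_nat_lt h0
    refine hz k (le_trans ?_ hk.le)
    rw [ENNReal.inv_le_inv]
    exact le_self_add
  set ε : ENNReal := ((m : ENNReal) + 1)⁻¹ with hε
  have hε0 : ε ≠ 0 := by simp [hε]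
  have hεt : ε ≠ ⊤ := by simp [hε]
  -- Steinhaus argument: for small u the compact set K and its translate overlap in at least half
  -- the measure of K, and on the overlap both factors are at least ε.
  obtain ⟨K, hKs, hK, hKpos⟩ := MeasurableSet.exists_lt_isCompact
    (measurableSet_le measurable_const hφ : MeasurableSet {z | ε ≤ φ z}) hm
  have hKt : volume K ≠ ⊤ := hK.measure_lt_top.ne
  have htend := tendsto_measure_vadd_sdiff_isCompact_isClosed (G := ℝ) (μ := volume) hK hK.isClosed
  have hev := htend.eventually_lt_const (ENNReal.half_pos hKpos.ne')
  rw [Metric.eventually_nhds_iff] at hev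
  obtain ⟨r, hr, hrv⟩ := hev
  refine ⟨(ε * ε * (volume K / 2)).toReal, ?_, r / 2, by positivity, fun u hu => ?_⟩
  · refine ENNReal.toReal_pos ?_ ?_
    · simp [hε0, hKpos.ne']
    · exact ENNReal.mul_ne_top (ENNReal.mul_ne_top hεt hεt) (ENNReal.div_ne_top hKt (by simp))
  rw [ENNReal.ofReal_toReal
    (ENNReal.mul_ne_top (ENNReal.mul_ne_top hεt hεt) (ENNReal.div_ne_top hKt (by simp)))]
  have hd := hrv (y := u) (by rw [Real.dist_eq]; simp; linarith)
  have hmeas : MeasurableSet (u +ᵥ K) := (hK.vadd u).measurableSet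
  have hvadd : volume (u +ᵥ K) = volume K := measure_vadd _ _ _
  have hinter : volume K / 2 ≤ volume ((u +ᵥ K) ∩ K) := by
    have h1 := measure_inter_add_sdiff (μ := volume) (u +ᵥ K) hK.measurableSet
    rw [hvadd] at h1
    by_contra hcon
    push Not at hcon
    have := ENNReal.add_lt_add hcon hd
    rw [h1, ENNReal.add_halves] at this
    exact lt_irrefl _ this
  have hsub : ∫⁻ x, φ x * φ (x + u) = ∫⁻ x, φ (-u + x) * φ x := by
    rw [← lintegral_add_left_eq_self _ (-u)]
    refine lintegral_congr fun x => ?_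
    congr 2; ring
  rw [hsub]
  calc ε * ε * (volume K / 2) ≤ ε * ε * volume ((u +ᵥ K) ∩ K) := by gcongr
    _ = ∫⁻ x in (u +ᵥ K) ∩ K, ε * ε := by simp
    _ ≤ ∫⁻ x in (u +ᵥ K) ∩ K, φ (-u + x) * φ x := by
        refine setLIntegral_mono (by fun_prop) fun x hx => ?_
        refine mul_le_mul' (hKs ?_) (hKs hx.2)
        simpa [Set.mem_vadd_set_iff_neg_vadd_mem] using hx.1
    _ ≤ _ := setLIntegral_le_lintegral _ _

/-- The distribution function of the difference of two independent variables with a density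
increases at least linearly near the origin. -/
theorem exists_linear_growth_diffDistFun {φ : ℝ → ENNReal} (hφ : Measurable φ)
    [IsProbabilityMeasure (volume.withDensity φ)] :
    ∃ c : ℝ, 0 < c ∧ ∃ r : ℝ, 0 < r ∧ ∀ s t, -r ≤ s → s ≤ t → t ≤ r →
      c * (t - s) ≤ diffDistFun (volume.withDensity φ) t - diffDistFun (volume.withDensity φ) s := by
  obtain ⟨c, hc, r, hr, h⟩ := exists_le_lintegral_mul_shift hφ (IsProbabilityMeasure.ne_zero _)
  refine ⟨c, hc, r, hr, fun s t hs hst ht => ?_⟩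
  set ν := volume.withDensity φ with hν
  have hsplit : diffDistFun ν t - diffDistFun ν s =
      (ν.prod ν).real {p : ℝ × ℝ | p.2 - p.1 ∈ Set.Ioc s t} := by
    rw [diffDistFun, diffDistFun, ← measureReal_sdiff _ (measurableSet_snd_le_fst_add s)]
    · congr 1
      ext p
      simp only [Set.mem_sdiff, Set.mem_ofPred_eq, Set.mem_Ioc, not_le]
      constructor <;> rintro ⟨h1, h2⟩ <;> constructor <;> linarith
    · intro p hp
      simp only [Set.mem_ofPred_eq] at hp ⊢
      linarith
  rw [hsplit, measureReal_def, ← ENNReal.ofReal_le_iff_le_toReal (measure_ne_top _ _),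
    hν, lintegral_diff_strip_eq hφ, ENNReal.ofReal_mul hc.le]
  calc ENNReal.ofReal c * ENNReal.ofReal (t - s) = ∫⁻ u in Set.Ioc s t, ENNReal.ofReal c := by simp
    _ ≤ _ := by
      refine setLIntegral_mono' measurableSet_Ioc fun u hu => h u ?_
      rw [abs_le]; constructor <;> linarith [hu.1, hu.2]

/-! ### Periodicity and distance on the circle -/

theorem abs_sub_le_of_periodic_lipschitz {f : ℝ → ℝ} {L : NNReal} (hper : Function.Periodic f 1)
    (hlip : LipschitzWith L f) (x y : ℝ) : |f x - f y| ≤ L := by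
  have h1 : f x = f (y + Int.fract (x - y)) := by
    have := hper.sub_int_mul_eq (x := x) ⌊x - y⌋
    rw [← this]
    congr 1
    rw [Int.fract]
    ring
  have h2 := hlip.dist_le_mul (y + Int.fract (x - y)) y
  rw [Real.dist_eq, Real.dist_eq, ← h1, add_sub_cancel_left,
    abs_of_nonneg (a := Int.fract (x - y)) (Int.fract_nonneg _)] at h2
  refine h2.trans ?_
  have := mul_le_mul_of_nonneg_left (Int.fract_lt_one (x - y)).le L.2
  simpa using this

theorem exists_abs_eq_circleDist (a b : ℝ) : ∃ k : ℤ, |a - k - b| = circleDist a b := by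
  refine ⟨round (a - b), ?_⟩
  rw [circleDist, UnitAddCircle.norm_eq]
  congr 1; ring

theorem circleDist_nonneg (a b : ℝ) : 0 ≤ circleDist a b := norm_nonneg _

theorem circleDist_le_half (a b : ℝ) : circleDist a b ≤ 1 / 2 := by
  have := AddCircle.norm_le_half_period (1 : ℝ) one_ne_zero (x := ((a - b : ℝ) : UnitAddCircle))
  simpa [circleDist] using this

/-- The mean square distance between two shifts of the template dominates the squared distance
of the shifts on the circle. -/
theorem exists_sq_circleDist_le_integral {f : ℝ → ℝ} {θstar : ℝ} (hf : Continuous f)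
    (hper : Function.Periodic f 1)
    (hexact : ∀ θ : ℝ, ¬ EqModOne θ θstar →
      0 < volume {x : ℝ | x ∈ Set.Icc (0 : ℝ) 1 ∧ f (x - θ) ≠ f (x - θstar)}) :
    ∃ c : ℝ, 0 < c ∧ ∀ θ,
      c * circleDist θ θstar ^ 2 ≤ ∫ x in (0 : ℝ)..1, (f (x + (θstar - θ)) - f x) ^ 2 := by
  have hpos : ∀ t, 0 < t → t ≤ 1 / 2 → 0 < ∫ x in (0 : ℝ)..1, (f (x + t) - f x) ^ 2 := by
    intro t ht ht2
    have hne : ¬ EqModOne (θstar - t) θstar := by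
      rintro ⟨k, hk⟩
      have h1 : -t = k := by linarith
      have h2 : (-1 : ℝ) < k := by linarith
      have h3 : (k : ℝ) < 0 := by linarith
      have h4 : -1 < k := by exact_mod_cast h2
      have h5 : k < 0 := by exact_mod_cast h3
      omega
    obtain ⟨x, -, hx⟩ := nonempty_of_measure_ne_zero (hexact _ hne).ne'
    refine intervalIntegral.integral_pos zero_lt_one (by fun_prop) (fun _ _ => sq_nonneg _)
      ⟨Int.fract (x - θstar), ⟨Int.fract_nonneg _, (Int.fract_lt_one _).le⟩, ?_⟩
    have e1 : f (Int.fract (x - θstar)) = f (x - θstar) := by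
      have := hper.sub_int_mul_eq (x := x - θstar) ⌊x - θstar⌋
      rw [← this, Int.fract]; congr 1; ring
    have e2 : f (Int.fract (x - θstar) + t) = f (x - (θstar - t)) := by
      have := hper.sub_int_mul_eq (x := x - (θstar - t)) ⌊x - θstar⌋
      rw [← this, Int.fract]; congr 1; ring
    rw [e1, e2]
    have := sub_ne_zero.2 hx
    positivity
  obtain ⟨c, hc, h⟩ := exists_sq_le_integral_sq_shift hf hper hpos
  refine ⟨c, hc, fun θ => ?_⟩
  rcases (circleDist_nonneg θ θstar).eq_or_lt with h0 | h0
  · rw [← h0]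
    have : 0 ≤ ∫ x in (0 : ℝ)..1, (f (x + (θstar - θ)) - f x) ^ 2 :=
      intervalIntegral.integral_nonneg zero_le_one fun x _ => sq_nonneg _
    simpa using this
  refine (h _ h0 (circleDist_le_half _ _)).trans_eq ?_
  obtain ⟨k, hk⟩ := exists_abs_eq_circleDist θ θstar
  -- The bound above is for a positive shift. If θ* - θ is minus the distance modulo 1, translating
  -- the integration variable exchanges the two terms of the square.
  rcases abs_choice (θ - k - θstar) with hs | hs
  · rw [hs] at hk
    have hp : Function.Periodic (fun x => (f x - f (x + circleDist θ θstar)) ^ 2) 1 := by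
      intro x
      simp only
      rw [hper x, show x + 1 + circleDist θ θstar = x + circleDist θ θstar + 1 by ring, hper]
    have h1 := intervalIntegral.integral_comp_add_right (a := 0) (b := 1)
      (fun x => (f x - f (x + circleDist θ θstar)) ^ 2) (θstar - θ)
    have h2 := hp.intervalIntegral_add_eq (θstar - θ) 0
    simp only [zero_add] at h1 h2
    rw [add_comm (1 : ℝ), h2] at h1
    calc _ = ∫ x in (0 : ℝ)..1, (f x - f (x + circleDist θ θstar)) ^ 2 := by
            refine intervalIntegral.integral_congr fun x _ => ?_
            ring
      _ = _ := by
            rw [← h1]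
            refine intervalIntegral.integral_congr fun x _ => ?_
            rw [← hk, ← hper.sub_int_mul_eq (x := x) k]
            congr 3; ring
  · rw [hs] at hk
    refine intervalIntegral.integral_congr fun x _ => ?_
    rw [← hk, ← hper.sub_int_mul_eq (x := x + -(θ - k - θstar)) k]
    congr 3; ring

/-! ### Quadratic separation of the expected objective -/

/-- Growth is known only on [-r, r], while h may be as large as B. Shrinking h by the factor r / (2B
+ r) keeps d + lh in that window, and monotonicity carries the gain on to d + h. -/
theorem sq_le_mul_of_linear_growth {q : ℝ → ℝ} (hq : Monotone q) {c r B : ℝ}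
    (hr : 0 < r) (hB : 0 < B)
    (hgrow : ∀ s t, -r ≤ s → s ≤ t → t ≤ r → c * (t - s) ≤ q t - q s) {d h : ℝ}
    (hd : |d| ≤ r / 2) (hh : |h| ≤ B) :
    c * (r / (2 * B + r)) * h ^ 2 ≤ (q (d + h) - q d) * h := by
  set l := r / (2 * B + r) with hl
  have hl0 : 0 < l := by positivity
  have hl1 : l ≤ 1 := by rw [hl, div_le_one (by positivity)]; linarith
  have hlB : l * B ≤ r / 2 := by
    rw [hl, div_mul_eq_mul_div, div_le_div_iff₀ (by positivity) (by norm_num)]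
    nlinarith
  have hlh : l * |h| ≤ r / 2 := (mul_le_mul_of_nonneg_left hh hl0.le).trans hlB
  rw [abs_le] at hd
  rcases le_total 0 h with h0 | h0
  · rw [abs_of_nonneg h0] at hlh
    have h1 := hgrow d (d + l * h) (by linarith) (by nlinarith) (by linarith)
    have h2 : q (d + l * h) ≤ q (d + h) := hq (by nlinarith)
    have h3 : c * (l * h) ≤ q (d + h) - q d := by linarith
    nlinarith [mul_le_mul_of_nonneg_right h3 h0]
  · rw [abs_of_nonpos h0] at hlh
    have h1 := hgrow (d + l * h) d (by linarith) (by nlinarith) (by linarith)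
    have h2 : q (d + h) ≤ q (d + l * h) := hq (by nlinarith)
    have h3 : q (d + h) - q d ≤ c * (l * h) := by linarith
    nlinarith [mul_le_mul_of_nonpos_right h3 h0]

/-- The average of the translates of `q` by the regression values `f (x_j - θ)`. -/
noncomputable def averagedDistFun (q f : ℝ → ℝ) (θ : ℝ) (n : ℕ) (u : ℝ) : ℝ :=
  (1 / (n : ℝ)) * ∑ j ∈ Finset.Icc 1 n, q (u - f ((j : ℝ) / n - θ))

theorem averagedDistFun_monotone {q : ℝ → ℝ} (hq : Monotone q) (f : ℝ → ℝ) (θ : ℝ) (n : ℕ) :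
    Monotone (averagedDistFun q f θ n) := by
  intro u v huv
  refine mul_le_mul_of_nonneg_left (Finset.sum_le_sum fun j _ => hq (by linarith)) (by positivity)

theorem abs_averagedDistFun_le_one {q : ℝ → ℝ} (hq0 : ∀ t, 0 ≤ q t) (hq1 : ∀ t, q t ≤ 1)
    (f : ℝ → ℝ) (θ : ℝ) (n : ℕ) (u : ℝ) : |averagedDistFun q f θ n u| ≤ 1 := by
  rw [averagedDistFun, abs_of_nonneg
    (mul_nonneg (by positivity) (Finset.sum_nonneg fun j _ => hq0 _))]
  rcases Nat.eq_zero_or_pos n with rfl | hn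
  · simp
  · have : ∑ j ∈ Finset.Icc 1 n, q (u - f ((j : ℝ) / n - θ)) ≤ ∑ j ∈ Finset.Icc 1 n, (1 : ℝ) :=
      Finset.sum_le_sum fun j _ => hq1 _
    have hn' : (0 : ℝ) < n := by exact_mod_cast hn
    rw [one_div_mul_eq_div, div_le_one hn']
    simpa using this

/-- Design points within ρ of x_i have values within r/2 of a_i, so their terms grow linearly. They
form a proportion at least ρ, uniformly in n and i, and monotonicity makes the other terms
nonnegative. -/
theorem exists_averagedDistFun_growth {f : ℝ → ℝ} {L : NNReal} (hL : 0 < L)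
    (hlip : LipschitzWith L f) (θ : ℝ) {q : ℝ → ℝ} (hq : Monotone q)
    {c r : ℝ} (hc : 0 < c) (hr : 0 < r)
    (hgrow : ∀ s t, -r ≤ s → s ≤ t → t ≤ r → c * (t - s) ≤ q t - q s) :
    ∃ κ : ℝ, 0 < κ ∧ ∀ n : ℕ, n ≠ 0 → ∀ i ∈ Finset.Icc 1 n, ∀ h : ℝ, |h| ≤ L →
      κ * h ^ 2 ≤ (averagedDistFun q f θ n (f ((i : ℝ) / n - θ) + h) -
        averagedDistFun q f θ n (f ((i : ℝ) / n - θ))) * h := by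
  have hL' : (0 : ℝ) < L := hL
  set ρ : ℝ := min (r / (2 * L)) (1 / 2) with hρ
  have hρ0 : 0 < ρ := lt_min (by positivity) (by norm_num)
  set κ := c * (r / (2 * L + r)) with hκ
  have hκ0 : 0 < κ := by positivity
  refine ⟨ρ * κ, by positivity, fun n hn i hi h hh => ?_⟩
  have hn0 : (0 : ℝ) < n := by positivity
  set a : ℕ → ℝ := fun j => f ((j : ℝ) / n - θ) with ha
  set S := (Finset.Icc 1 n).filter (fun j : ℕ => |(i : ℝ) / n - (j : ℝ) / n| ≤ ρ) with hS
  have hcard := card_mul_le_card_filter_Icc hi hρ0.le (min_le_right _ _)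
  have hfar : ∀ j, 0 ≤ (q (a i - a j + h) - q (a i - a j)) * h := by
    intro j
    rcases le_total 0 h with h0 | h0
    · exact mul_nonneg (sub_nonneg.2 (hq (by linarith))) h0
    · exact mul_nonneg_of_nonpos_of_nonpos (sub_nonpos.2 (hq (by linarith))) h0
  have hnear : ∀ j ∈ S, κ * h ^ 2 ≤ (q (a i - a j + h) - q (a i - a j)) * h := by
    intro j hj
    refine sq_le_mul_of_linear_growth hq hr hL' hgrow ?_ hh
    have h1 := hlip.dist_le_mul ((i : ℝ) / n - θ) ((j : ℝ) / n - θ)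
    rw [Real.dist_eq, Real.dist_eq, sub_sub_sub_cancel_right] at h1
    refine h1.trans ?_
    have h2 := mul_le_mul_of_nonneg_left
      ((Finset.mem_filter.1 hj).2.trans (min_le_left _ _)) L.2
    refine h2.trans_eq ?_
    change (L : ℝ) * _ = _
    field_simp
  have hsum : (S.card : ℝ) * (κ * h ^ 2) ≤
      ∑ j ∈ Finset.Icc 1 n, (q (a i - a j + h) - q (a i - a j)) * h := by
    rw [← nsmul_eq_mul]
    refine (Finset.card_nsmul_le_sum S _ _ hnear).trans ?_
    exact Finset.sum_le_sum_of_subset_of_nonneg (Finset.filter_subset _ _) fun j _ _ => hfar j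
  have heq : (averagedDistFun q f θ n (a i + h) - averagedDistFun q f θ n (a i)) * h =
      (1 / (n : ℝ)) * ∑ j ∈ Finset.Icc 1 n, (q (a i - a j + h) - q (a i - a j)) * h := by
    rw [averagedDistFun, averagedDistFun, ← mul_sub, ← Finset.sum_sub_distrib, mul_assoc,
      Finset.sum_mul]
    congr 1
    refine Finset.sum_congr rfl fun j _ => ?_
    rw [show a i + h - f ((j : ℝ) / n - θ) = a i - a j + h by simp only [ha]; ring]
  change _ ≤ (averagedDistFun q f θ n (a i + h) - averagedDistFun q f θ n (a i)) * h
  rw [heq]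
  have h1 : (n : ℝ) * ρ * (κ * h ^ 2) ≤ S.card * (κ * h ^ 2) :=
    mul_le_mul_of_nonneg_right hcard (by positivity)
  rw [one_div_mul_eq_div, le_div_iff₀ hn0]
  linarith

theorem lipschitzWith_sq_shift_sub {f : ℝ → ℝ} {L : NNReal} (hper : Function.Periodic f 1)
    (hlip : LipschitzWith L f) (t : ℝ) :
    LipschitzWith (4 * L ^ 2) fun x => (f (x + t) - f x) ^ 2 := by
  refine LipschitzWith.of_dist_le_mul fun x y => ?_
  rw [Real.dist_eq, Real.dist_eq, sq_sub_sq, abs_mul]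
  have h1 := hlip.dist_le_mul (x + t) (y + t)
  have h2 := hlip.dist_le_mul x y
  rw [Real.dist_eq, Real.dist_eq] at h1 h2
  rw [add_sub_add_right_eq_sub] at h1
  have h3 := abs_sub_le_of_periodic_lipschitz hper hlip (x + t) x
  have h4 := abs_sub_le_of_periodic_lipschitz hper hlip (y + t) y
  have h5 : |f (x + t) - f x + (f (y + t) - f y)| ≤ 2 * L := by
    rw [abs_le] at *; constructor <;> linarith
  have h6 : |f (x + t) - f x - (f (y + t) - f y)| ≤ 2 * (L * |x - y|) := by
    rw [abs_le] at *; constructor <;> linarith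
  refine (mul_le_mul h5 h6 (abs_nonneg _) (by positivity)).trans_eq ?_
  push_cast
  ring

/-- Discrete Bregman inequality for the averaged distribution function along the template. -/
theorem sum_averagedDistFun_mul_sub_ge {f : ℝ → ℝ} {L : NNReal} (hper : Function.Periodic f 1)
    (hlip : LipschitzWith L f) (θstar : ℝ) {q : ℝ → ℝ} (hq : Monotone q) (hq0 : ∀ t, 0 ≤ q t)
    (hq1 : ∀ t, q t ≤ 1) {κ : ℝ} {n : ℕ} (hn : n ≠ 0)
    (hκ : ∀ i ∈ Finset.Icc 1 n, ∀ h : ℝ, |h| ≤ L →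
      κ * h ^ 2 ≤ (averagedDistFun q f θstar n (f ((i : ℝ) / n - θstar) + h) -
        averagedDistFun q f θstar n (f ((i : ℝ) / n - θstar))) * h) (θ : ℝ) :
    κ / 2 * ((1 / (n : ℝ)) * ∑ i ∈ Finset.Icc 1 n,
        (f ((i : ℝ) / n - θ) - f ((i : ℝ) / n - θstar)) ^ 2) - 2 * L / n ≤
      (1 / (n : ℝ)) * ∑ i ∈ Finset.Icc 1 n,
        averagedDistFun q f θstar n (f ((i : ℝ) / n - θstar)) *
          (f ((i : ℝ) / n - θstar) - f ((i : ℝ) / n - θ)) := by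
  set G := averagedDistFun q f θstar n with hG
  have hGm : Monotone G := averagedDistFun_monotone hq f θstar n
  -- Although G and Ψ depend on n, |G| ≤ 1 keeps Ψ ∘ f Lipschitz with constant L, so each of its two
  -- Riemann sums errs by at most L / n.
  set Ψ : ℝ → ℝ := fun u => ∫ s in (0 : ℝ)..u, G s with hΨ
  have hΨsub : ∀ u v, Ψ v - Ψ u = ∫ s in u..v, G s := fun u v =>
    intervalIntegral.integral_interval_sub_left hGm.intervalIntegrable hGm.intervalIntegrable
  have hΨlip : LipschitzWith 1 Ψ := by
    refine LipschitzWith.of_dist_le_mul fun u v => ?_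
    rw [Real.dist_eq, Real.dist_eq, hΨsub]
    exact intervalIntegral.norm_integral_le_of_norm_le_const (f := G) (C := 1) fun s _ =>
      abs_averagedDistFun_le_one hq0 hq1 f θstar n s
  have hcomp : LipschitzWith L (Ψ ∘ f) := by simpa using hΨlip.comp hlip
  have hcper : Function.Periodic (Ψ ∘ f) 1 := fun x => by simp [hper x]
  have h1 := abs_riemannSum_sub_integral_le hcper hcomp hn θ
  have h2 := abs_riemannSum_sub_integral_le hcper hcomp hn θstar
  rw [abs_le] at h1 h2
  have hterm : ∑ i ∈ Finset.Icc 1 n,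
      (κ / 2 * (f ((i : ℝ) / n - θ) - f ((i : ℝ) / n - θstar)) ^ 2) ≤
      ∑ i ∈ Finset.Icc 1 n, (((Ψ ∘ f) ((i : ℝ) / n - θ) - (Ψ ∘ f) ((i : ℝ) / n - θstar)) +
        G (f ((i : ℝ) / n - θstar)) * (f ((i : ℝ) / n - θstar) - f ((i : ℝ) / n - θ))) := by
    refine Finset.sum_le_sum fun i hi => ?_
    have hab := abs_sub_le_of_periodic_lipschitz hper hlip ((i : ℝ) / n - θ) ((i : ℝ) / n - θstar)
    have := le_integral_of_linear_growth hGm (κ := κ) (a := f ((i : ℝ) / n - θstar))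
      (b := f ((i : ℝ) / n - θ)) (by
        intro s hs
        have h3 := hκ i hi (s - f ((i : ℝ) / n - θstar))
          ((Set.abs_sub_left_of_mem_uIcc hs).trans hab)
        rwa [add_sub_cancel] at h3)
    simp only [Function.comp]
    rw [hΨsub]
    linarith
  have hn0 : (0 : ℝ) ≤ 1 / n := by positivity
  have := mul_le_mul_of_nonneg_left hterm hn0
  rw [Finset.sum_add_distrib, Finset.sum_sub_distrib, ← Finset.mul_sum, mul_add, mul_sub] at this
  have e : 2 * (L : ℝ) / n = L / n + L / n := by ring
  rw [e]
  linarith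

/-- The expectation of the rank objective has a quadratically separated maximum at `θ*`, up to an
error of order `1 / n`. The separation is global on the circle, by convexity of the primitive of the
averaged distribution function, so that uniqueness of the maximum of the limit objective is a
consequence and need not be assumed. -/
theorem exists_quadratic_separation {f : ℝ → ℝ} {L : NNReal} (hL : 0 < L)
    (hper : Function.Periodic f 1) (hlip : LipschitzWith L f) {θstar : ℝ}
    (hexact : ∀ θ : ℝ, ¬ EqModOne θ θstar →
      0 < volume {x : ℝ | x ∈ Set.Icc (0 : ℝ) 1 ∧ f (x - θ) ≠ f (x - θstar)})
    {q : ℝ → ℝ} (hq : Monotone q) (hq0 : ∀ t, 0 ≤ q t) (hq1 : ∀ t, q t ≤ 1)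
    {c r : ℝ} (hc : 0 < c) (hr : 0 < r)
    (hgrow : ∀ s t, -r ≤ s → s ≤ t → t ≤ r → c * (t - s) ≤ q t - q s) :
    ∃ c₁ : ℝ, 0 < c₁ ∧ ∃ C : ℝ, 0 < C ∧ ∀ n : ℕ, n ≠ 0 → ∀ θ,
      c₁ * circleDist θ θstar ^ 2 - C / n ≤
        (1 / (n : ℝ)) * ∑ i ∈ Finset.Icc 1 n,
          ((1 / (n : ℝ)) * ∑ j ∈ Finset.Icc 1 n,
            if i = j then 1 else q (f ((i : ℝ) / n - θstar) - f ((j : ℝ) / n - θstar))) *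
          (f ((i : ℝ) / n - θstar) - f ((i : ℝ) / n - θ)) := by
  have hL' : (0 : ℝ) < L := hL
  obtain ⟨κ, hκ, hκG⟩ := exists_averagedDistFun_growth hL hlip θstar hq hc hr hgrow
  obtain ⟨c₂, hc₂, hD⟩ := exists_sq_circleDist_le_integral hlip.continuous hper hexact
  -- The three errors come from the Riemann sum of the squared increment, the Bregman inequality and
  -- the diagonal i = j.
  refine ⟨κ / 2 * c₂, by positivity, κ / 2 * (4 * L ^ 2) + 2 * L + L, by positivity,
    fun n hn θ => ?_⟩
  have hn0 : (0 : ℝ) < n := by positivity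
  have h1 := sum_averagedDistFun_mul_sub_ge hper hlip θstar hq hq0 hq1 hn (hκG n hn) θ
  have hgper : Function.Periodic (fun x => (f (x + (θstar - θ)) - f x) ^ 2) 1 := by
    intro x
    simp only
    rw [hper x, show x + 1 + (θstar - θ) = x + (θstar - θ) + 1 by ring, hper]
  have h2 := abs_riemannSum_sub_integral_le hgper
    (lipschitzWith_sq_shift_sub hper hlip (θstar - θ)) hn θstar
  simp only [show ∀ i : ℕ, (i : ℝ) / n - θstar + (θstar - θ) = (i : ℝ) / n - θ by
    intro i; ring] at h2
  have h3 := (abs_le.1 h2).1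
  push_cast at h3
  have h4 := hD θ
  -- The diagonal term is 1 instead of q 0, which shifts every row average by (1 - q 0) / n.
  have hinner : ∀ i ∈ Finset.Icc 1 n, (1 / (n : ℝ)) * ∑ j ∈ Finset.Icc 1 n,
      (if i = j then 1 else q (f ((i : ℝ) / n - θstar) - f ((j : ℝ) / n - θstar))) =
      averagedDistFun q f θstar n (f ((i : ℝ) / n - θstar)) + (1 / (n : ℝ)) * (1 - q 0) := by
    intro i hi
    rw [averagedDistFun, ← mul_add]
    congr 1
    rw [← Finset.add_sum_erase _ _ hi, ← Finset.add_sum_erase _ (fun j : ℕ =>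
      q (f ((i : ℝ) / n - θstar) - f ((j : ℝ) / n - θstar))) hi]
    have : ∀ j ∈ (Finset.Icc 1 n).erase i,
        (if i = j then 1 else q (f ((i : ℝ) / n - θstar) - f ((j : ℝ) / n - θstar))) =
        q (f ((i : ℝ) / n - θstar) - f ((j : ℝ) / n - θstar)) := fun j hj =>
      if_neg (Finset.ne_of_mem_erase hj).symm
    rw [Finset.sum_congr rfl this, sub_self]
    simp only [if_true]
    ring
  rw [Finset.sum_congr rfl fun i hi => by rw [hinner i hi, add_mul], Finset.sum_add_distrib,
    mul_add]
  have hdiag : -(L / n : ℝ) ≤ (1 / (n : ℝ)) * ∑ i ∈ Finset.Icc 1 n,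
      (1 / (n : ℝ)) * (1 - q 0) * (f ((i : ℝ) / n - θstar) - f ((i : ℝ) / n - θ)) := by
    have : ∑ i ∈ Finset.Icc 1 n, (-(L / n : ℝ)) ≤ ∑ i ∈ Finset.Icc 1 n,
        (1 / (n : ℝ)) * (1 - q 0) * (f ((i : ℝ) / n - θstar) - f ((i : ℝ) / n - θ)) := by
      refine Finset.sum_le_sum fun i _ => ?_
      have hb := (abs_le.1 (abs_sub_le_of_periodic_lipschitz hper hlip
        ((i : ℝ) / n - θstar) ((i : ℝ) / n - θ))).1
      have hp0 : 0 ≤ 1 - q 0 := by linarith [hq1 0]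
      have hp1 : 1 - q 0 ≤ 1 := by linarith [hq0 0]
      rw [mul_assoc, neg_div', div_eq_mul_one_div, mul_comm]
      refine mul_le_mul_of_nonneg_left ?_ (by positivity)
      nlinarith
    have := mul_le_mul_of_nonneg_left this (by positivity : (0 : ℝ) ≤ 1 / n)
    rw [Finset.sum_const, Nat.card_Icc, nsmul_eq_mul] at this
    refine le_trans (le_of_eq ?_) this
    simp
    field_simp
  have hκ2 : 0 ≤ κ / 2 := by positivity
  have h5 := mul_le_mul_of_nonneg_left (by linarith : c₂ * circleDist θ θstar ^ 2 -
    4 * L ^ 2 / n ≤ 1 / (n : ℝ) * ∑ i ∈ Finset.Icc 1 n,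
        (f ((i : ℝ) / n - θ) - f ((i : ℝ) / n - θstar)) ^ 2) hκ2
  have e : (κ / 2 * (4 * L ^ 2) + 2 * L + L : ℝ) / n =
    κ / 2 * (4 * L ^ 2 / n) + 2 * L / n + L / n := by ring
  rw [e]
  linarith

/-! ### Weighted means and their increments -/

/-- The weighted mean of `g (x_i - θ)` with weights the row averages of the matrix `A`. -/
noncomputable def weightedMean (n : ℕ) (A : ℕ → ℕ → ℝ) (g : ℝ → ℝ) (θ : ℝ) : ℝ :=
  (1 / (n : ℝ)) * ∑ i ∈ Finset.Icc 1 n,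
    ((1 / (n : ℝ)) * ∑ j ∈ Finset.Icc 1 n, A i j) * g ((i : ℝ) / n - θ)

theorem weightedMean_sub (n : ℕ) (A B : ℕ → ℕ → ℝ) (g : ℝ → ℝ) (θ : ℝ) :
    weightedMean n (fun i j => A i j - B i j) g θ = weightedMean n A g θ - weightedMean n B g θ := by
  simp only [weightedMean, Finset.sum_sub_distrib, mul_sub, sub_mul]

theorem weightedMean_eq_double_sum (n : ℕ) (A : ℕ → ℕ → ℝ) (g : ℝ → ℝ) (θ : ℝ) :
    weightedMean n A g θ = ((n : ℝ) ^ 2)⁻¹ *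
      ∑ i ∈ Finset.Icc 1 n, ∑ j ∈ Finset.Icc 1 n, A i j * g ((i : ℝ) / n - θ) := by
  simp only [weightedMean, Finset.mul_sum, Finset.sum_mul]
  refine Finset.sum_congr rfl fun i _ => Finset.sum_congr rfl fun j _ => ?_
  ring

theorem integral_deriv_of_lipschitz {f : ℝ → ℝ} {L : NNReal} (hlip : LipschitzWith L f)
    (a b : ℝ) : ∫ x in a..b, deriv f x = f b - f a :=
  (hlip.lipschitzOnWith (s := Set.uIcc a b)).absolutelyContinuousOnInterval.integral_deriv_eq_sub

theorem intervalIntegrable_deriv_of_lipschitz {f : ℝ → ℝ} {L : NNReal}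
    (hlip : LipschitzWith L f) (a b : ℝ) : IntervalIntegrable (deriv f) volume a b :=
  (hlip.lipschitzOnWith (s := Set.uIcc a b)).absolutelyContinuousOnInterval.intervalIntegrable_deriv

/-- Reduces increments in θ to the process at fixed s, for which a pointwise moment bound suffices.
The sign comes from θ entering as x - θ. -/
theorem weightedMean_sub_eq_integral {f : ℝ → ℝ} {L : NNReal} (hlip : LipschitzWith L f) (n : ℕ)
    (A : ℕ → ℕ → ℝ) (θ θstar : ℝ) :
    weightedMean n A f θ - weightedMean n A f θstar =
      -∫ s in θstar..θ, weightedMean n A (deriv f) s := by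
  have hint : ∀ x : ℝ, IntervalIntegrable (fun s => deriv f (x - s)) volume θstar θ := by
    intro x
    have := (intervalIntegrable_deriv_of_lipschitz hlip (x - θstar) (x - θ)).comp_sub_left x
    simpa using this
  have hval : ∀ x : ℝ, ∫ s in θstar..θ, deriv f (x - s) = f (x - θstar) - f (x - θ) := by
    intro x
    rw [intervalIntegral.integral_comp_sub_left (deriv f) x, integral_deriv_of_lipschitz hlip]
  simp only [weightedMean]
  rw [intervalIntegral.integral_const_mul, intervalIntegral.integral_finsetSum
    (fun i _ => (hint _).const_mul _)]
  simp_rw [intervalIntegral.integral_const_mul, hval]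
  rw [← mul_sub, ← Finset.sum_sub_distrib, ← mul_neg, ← Finset.sum_neg_distrib]
  congr 1
  refine Finset.sum_congr rfl fun i _ => ?_
  ring

/-! ### Moment and uniform bounds for the noise process -/

variable {Ω : Type*} [MeasurableSpace Ω]

/-- Second moment of a doubly indexed sum of bounded variables that are uncorrelated for disjoint
pairs of indices. -/
theorem integral_sq_double_sum_le (μ : Measure Ω) [IsProbabilityMeasure μ] {ξ : ℕ → ℕ → Ω → ℝ}
    (hm : ∀ i j, Measurable (ξ i j)) (hb : ∀ i j ω, |ξ i j ω| ≤ 1)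
    (h0 : ∀ i j k l, i ≠ k → i ≠ l → j ≠ k → j ≠ l → ∫ ω, ξ i j ω * ξ k l ω ∂μ = 0)
    {g : ℕ → ℝ} {L : ℝ} (hg : ∀ i, |g i| ≤ L) (s : Finset ℕ) :
    ∫ ω, (∑ i ∈ s, ∑ j ∈ s, ξ i j ω * g i) ^ 2 ∂μ ≤ 4 * L ^ 2 * (s.card : ℝ) ^ 3 := by
  have hL : 0 ≤ L := (abs_nonneg _).trans (hg 0)
  have hint : ∀ i j k l, Integrable (fun ω => ξ i j ω * g i * (ξ k l ω * g k)) μ := by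
    intro i j k l
    refine Integrable.of_bound (((hm i j).mul_const _).mul ((hm k l).mul_const _)).aestronglyMeasurable
      (1 * L * (1 * L)) (Filter.Eventually.of_forall fun ω => ?_)
    rw [Real.norm_eq_abs, abs_mul, abs_mul, abs_mul]
    gcongr
    exacts [hb _ _ _, hg _, hb _ _ _, hg _]
  have hexp : ∀ ω, (∑ i ∈ s, ∑ j ∈ s, ξ i j ω * g i) ^ 2 =
      ∑ i ∈ s, ∑ k ∈ s, ∑ j ∈ s, ∑ l ∈ s, ξ i j ω * g i * (ξ k l ω * g k) := by
    intro ω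
    rw [sq, Finset.sum_mul_sum]
    simp_rw [Finset.sum_mul_sum]
  -- Only quadruples with a coincidence between the two pairs contribute. Each of the four
  -- coincidences leaves card³ quadruples, whence the factor 4.
  have hterm : ∀ i j k l, ∫ ω, ξ i j ω * g i * (ξ k l ω * g k) ∂μ ≤
      L ^ 2 * ((if i = k then 1 else 0) + (if i = l then 1 else 0) + (if j = k then 1 else 0) +
        (if j = l then 1 else 0)) := by
    intro i j k l
    by_cases hd : i ≠ k ∧ i ≠ l ∧ j ≠ k ∧ j ≠ l
    · have : ∀ ω, ξ i j ω * g i * (ξ k l ω * g k) = g i * g k * (ξ i j ω * ξ k l ω) :=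
        fun ω => by ring
      simp_rw [this]
      rw [integral_const_mul, h0 i j k l hd.1 hd.2.1 hd.2.2.1 hd.2.2.2]
      simp [hd.1, hd.2.1, hd.2.2.1, hd.2.2.2]
    · have h1 : ∫ ω, ξ i j ω * g i * (ξ k l ω * g k) ∂μ ≤ ∫ _ω, L ^ 2 ∂μ := by
        refine integral_mono (hint i j k l) (integrable_const _) fun ω => ?_
        refine (le_abs_self _).trans ?_
        rw [abs_mul, abs_mul, abs_mul]
        calc |ξ i j ω| * |g i| * (|ξ k l ω| * |g k|) ≤ 1 * L * (1 * L) := by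
              gcongr
              exacts [hb _ _ _, hg _, hb _ _ _, hg _]
          _ = L ^ 2 := by ring
      rw [integral_const, probReal_univ, one_smul] at h1
      refine h1.trans (le_mul_of_one_le_right (sq_nonneg L) ?_)
      split_ifs <;> first | (exfalso; tauto) | norm_num
  simp_rw [hexp]
  rw [integral_finsetSum _ fun i _ => integrable_finsetSum _ fun k _ => integrable_finsetSum _
    fun j _ => integrable_finsetSum _ fun l _ => hint i j k l]
  calc _ = ∑ i ∈ s, ∑ k ∈ s, ∑ j ∈ s, ∑ l ∈ s, ∫ ω, ξ i j ω * g i * (ξ k l ω * g k) ∂μ := by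
        refine Finset.sum_congr rfl fun i _ => ?_
        rw [integral_finsetSum _ fun k _ => integrable_finsetSum _
          fun j _ => integrable_finsetSum _ fun l _ => hint i j k l]
        refine Finset.sum_congr rfl fun k _ => ?_
        rw [integral_finsetSum _ fun j _ => integrable_finsetSum _ fun l _ => hint i j k l]
        refine Finset.sum_congr rfl fun j _ => ?_
        rw [integral_finsetSum _ fun l _ => hint i j k l]
    _ ≤ ∑ i ∈ s, ∑ k ∈ s, ∑ j ∈ s, ∑ l ∈ s, L ^ 2 * ((if i = k then 1 else 0) +
        (if i = l then 1 else 0) + (if j = k then 1 else 0) + (if j = l then 1 else 0)) :=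
        Finset.sum_le_sum fun i _ => Finset.sum_le_sum fun k _ => Finset.sum_le_sum fun j _ =>
          Finset.sum_le_sum fun l _ => hterm i j k l
    _ = _ := by
        simp only [← Finset.mul_sum, Finset.sum_add_distrib, Finset.sum_ite_eq, Finset.sum_const,
          nsmul_eq_mul, Finset.sum_ite_mem, Finset.inter_self, mul_ite, mul_one, mul_zero]
        simp
        ring

/-- The weight is 1 / (b² + (s - a)²): integrable, yet at least 1 / (2δ²) within distance δ of a
whenever δ ≥ b. -/
theorem integral_cauchyWeight {b : ℝ} (hb : 0 < b) (a : ℝ) :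
    ∫⁻ s, ENNReal.ofReal ((b ^ 2)⁻¹ * (1 + ((s - a) / b) ^ 2)⁻¹) = ENNReal.ofReal (Real.pi / b) := by
  have hint : Integrable fun s => (b ^ 2)⁻¹ * (1 + ((s - a) / b) ^ 2)⁻¹ :=
    ((integrable_inv_one_add_sq.comp_div hb.ne').comp_sub_right a).const_mul _
  rw [← ofReal_integral_eq_lintegral_ofReal hint
    (Filter.Eventually.of_forall fun s => by positivity), integral_const_mul,
    integral_sub_right_eq_self (fun s => (1 + (s / b) ^ 2)⁻¹) a,
    Measure.integral_comp_div (fun s => (1 + s ^ 2)⁻¹) b, integral_univ_inv_one_add_sq,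
    abs_of_pos hb, smul_eq_mul]
  congr 1
  field_simp

/-- The second moment is at most 4L² / n. The bound |v| ≤ √n v² / 2 + 1 / (2√n) turns it into a
first moment of order 1 / √n. -/
theorem lintegral_enorm_weightedMean_le (μ : Measure Ω) [IsProbabilityMeasure μ]
    {ξ : ℕ → ℕ → Ω → ℝ} (hm : ∀ i j, Measurable (ξ i j)) (hb : ∀ i j ω, |ξ i j ω| ≤ 1)
    (h0 : ∀ i j k l, i ≠ k → i ≠ l → j ≠ k → j ≠ l → ∫ ω, ξ i j ω * ξ k l ω ∂μ = 0)
    {g : ℝ → ℝ} {L : ℝ} (hg : ∀ x, |g x| ≤ L) {n : ℕ} (hn : n ≠ 0) (s : ℝ) :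
    ∫⁻ ω, ‖weightedMean n (fun i j => ξ i j ω) g s‖ₑ ∂μ ≤
      ENNReal.ofReal ((2 * L ^ 2 + 1) / Real.sqrt n) := by
  have hn0 : (0 : ℝ) < n := by positivity
  have hr : 0 < Real.sqrt n := Real.sqrt_pos.2 hn0
  have hr2 : Real.sqrt n ^ 2 = n := Real.sq_sqrt hn0.le
  set S : Ω → ℝ := fun ω => ∑ i ∈ Finset.Icc 1 n, ∑ j ∈ Finset.Icc 1 n,
    ξ i j ω * g ((i : ℝ) / n - s) with hS
  have hSm : Measurable S := by fun_prop
  have hV : ∀ ω, weightedMean n (fun i j => ξ i j ω) g s = ((n : ℝ) ^ 2)⁻¹ * S ω := fun ω =>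
    weightedMean_eq_double_sum _ _ _ _
  have hL : 0 ≤ L := (abs_nonneg _).trans (hg 0)
  have hSb : ∀ ω, |S ω| ≤ n * (n * L) := by
    intro ω
    have : ∀ i ∈ Finset.Icc 1 n, |∑ j ∈ Finset.Icc 1 n, ξ i j ω * g ((i : ℝ) / n - s)| ≤ n * L := by
      intro i _
      refine (Finset.abs_sum_le_sum_abs _ _).trans ((Finset.sum_le_card_nsmul _ _ L ?_).trans_eq ?_)
      · intro j _
        rw [abs_mul]
        exact (mul_le_mul (hb _ _ _) (hg _) (abs_nonneg _) zero_le_one).trans_eq (one_mul L)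
      · simp
    refine (Finset.abs_sum_le_sum_abs _ _).trans ((Finset.sum_le_card_nsmul _ _ _ this).trans_eq ?_)
    simp
  have hS2 : Integrable (fun ω => S ω ^ 2) μ := by
    refine Integrable.of_bound (hSm.pow_const 2).aestronglyMeasurable ((n * (n * L)) ^ 2)
      (Filter.Eventually.of_forall fun ω => ?_)
    rw [Real.norm_eq_abs, abs_pow]
    exact pow_le_pow_left₀ (abs_nonneg _) (hSb ω) 2
  have hmom := integral_sq_double_sum_le μ hm hb h0 (g := fun i : ℕ => g ((i : ℝ) / n - s))
    (fun i => hg _) (Finset.Icc 1 n)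
  rw [Nat.card_Icc, Nat.add_sub_cancel] at hmom
  have hpt : ∀ ω, |((n : ℝ) ^ 2)⁻¹ * S ω| ≤
      Real.sqrt n / 2 * ((n : ℝ) ^ 4)⁻¹ * S ω ^ 2 + 1 / (2 * Real.sqrt n) := by
    intro ω
    set v := ((n : ℝ) ^ 2)⁻¹ * S ω with hv
    have e : ((n : ℝ) ^ 4)⁻¹ * S ω ^ 2 = |v| ^ 2 := by
      rw [sq_abs, hv]; field_simp
    rw [mul_assoc, e]
    have h1 := sq_nonneg (Real.sqrt n * |v| - 1)
    have e2 : Real.sqrt n / 2 * |v| ^ 2 + 1 / (2 * Real.sqrt n) - |v| =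
        (Real.sqrt n * |v| - 1) ^ 2 / (2 * Real.sqrt n) := by
      field_simp
      ring
    have : 0 ≤ (Real.sqrt n * |v| - 1) ^ 2 / (2 * Real.sqrt n) := by positivity
    linarith
  have hRint : Integrable (fun ω => Real.sqrt n / 2 * ((n : ℝ) ^ 4)⁻¹ * S ω ^ 2 +
      1 / (2 * Real.sqrt n)) μ := (hS2.const_mul _).add (integrable_const _)
  calc ∫⁻ ω, ‖weightedMean n (fun i j => ξ i j ω) g s‖ₑ ∂μ
      ≤ ∫⁻ ω, ENNReal.ofReal (Real.sqrt n / 2 * ((n : ℝ) ^ 4)⁻¹ * S ω ^ 2 +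
          1 / (2 * Real.sqrt n)) ∂μ := by
        refine lintegral_mono fun ω => ?_
        rw [Real.enorm_eq_ofReal_abs, hV]
        exact ENNReal.ofReal_le_ofReal (hpt ω)
    _ = ENNReal.ofReal (∫ ω, (Real.sqrt n / 2 * ((n : ℝ) ^ 4)⁻¹ * S ω ^ 2 +
          1 / (2 * Real.sqrt n)) ∂μ) := by
        rw [ofReal_integral_eq_lintegral_ofReal hRint
          (Filter.Eventually.of_forall fun ω => by positivity)]
    _ ≤ _ := by
        refine ENNReal.ofReal_le_ofReal ?_
        rw [integral_add (hS2.const_mul _) (integrable_const _), integral_const_mul,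
          integral_const, probReal_univ, one_smul]
        have h1 : Real.sqrt n / 2 * ((n : ℝ) ^ 4)⁻¹ * ∫ ω, S ω ^ 2 ∂μ ≤
            Real.sqrt n / 2 * ((n : ℝ) ^ 4)⁻¹ * (4 * L ^ 2 * (n : ℝ) ^ 3) :=
          mul_le_mul_of_nonneg_left hmom (by positivity)
        have h2 : Real.sqrt n / 2 * ((n : ℝ) ^ 4)⁻¹ * (4 * L ^ 2 * (n : ℝ) ^ 3) =
            2 * L ^ 2 / Real.sqrt n := by
          field_simp
          rw [hr2]; ring
        have h3 : 1 / (2 * Real.sqrt n) ≤ 1 / Real.sqrt n := by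
          gcongr; linarith
        rw [add_div]
        linarith

/-- The increments of the noise process are of smaller order than the squared shift, outside a
neighbourhood of order `1 / √n`. -/
theorem measure_exists_weightedMean_sub_ge_le (μ : Measure Ω) [IsProbabilityMeasure μ]
    {ξ : ℕ → ℕ → Ω → ℝ} (hm : ∀ i j, Measurable (ξ i j)) (hb : ∀ i j ω, |ξ i j ω| ≤ 1)
    (h0 : ∀ i j k l, i ≠ k → i ≠ l → j ≠ k → j ≠ l → ∫ ω, ξ i j ω * ξ k l ω ∂μ = 0)
    {f : ℝ → ℝ} {L : NNReal} (hlip : LipschitzWith L f) (θstar : ℝ) {n : ℕ} (hn : n ≠ 0)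
    {b c : ℝ} (hb0 : 0 < b) (hc : 0 < c) :
    μ {ω | ∃ θ, b ≤ |θ - θstar| ∧ c * |θ - θstar| ^ 2 ≤
      |weightedMean n (fun i j => ξ i j ω) f θ - weightedMean n (fun i j => ξ i j ω) f θstar|} ≤
      ENNReal.ofReal ((2 * L ^ 2 + 1) / Real.sqrt n * (Real.pi / b) * (2 / c)) := by
  set V : ℝ → Ω → ℝ := fun s ω => weightedMean n (fun i j => ξ i j ω) (deriv f) s with hV
  set w : ℝ → ℝ := fun s => (b ^ 2)⁻¹ * (1 + ((s - θstar) / b) ^ 2)⁻¹ with hw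
  have hwm : Measurable w := by fun_prop
  have hdm : Measurable (deriv f) := measurable_deriv f
  have hVm : Measurable (Function.uncurry V) := by
    simp only [hV, weightedMean]
    change Measurable fun p : ℝ × Ω => _
    fun_prop
  have hgb : ∀ x, |deriv f x| ≤ L := fun x => norm_deriv_le_of_lipschitz hlip
  set T : Ω → ENNReal := fun ω => ∫⁻ s, ENNReal.ofReal (w s) * ‖V s ω‖ₑ with hT
  have hJm : Measurable fun p : Ω × ℝ => ENNReal.ofReal (w p.2) * ‖V p.2 p.1‖ₑ :=
    (ENNReal.measurable_ofReal.comp (hwm.comp measurable_snd)).mul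
      (hVm.comp measurable_swap).enorm
  have hTm : Measurable T := hJm.lintegral_prod_right'
  have hET : ∫⁻ ω, T ω ∂μ ≤
      ENNReal.ofReal ((2 * L ^ 2 + 1) / Real.sqrt n * (Real.pi / b)) := by
    rw [hT, lintegral_lintegral_swap hJm.aemeasurable]
    calc ∫⁻ s, ∫⁻ ω, ENNReal.ofReal (w s) * ‖V s ω‖ₑ ∂μ
        = ∫⁻ s, ENNReal.ofReal (w s) * ∫⁻ ω, ‖V s ω‖ₑ ∂μ := by
          refine lintegral_congr fun s => lintegral_const_mul' _ _ ENNReal.ofReal_ne_top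
      _ ≤ ∫⁻ s, ENNReal.ofReal (w s) * ENNReal.ofReal ((2 * L ^ 2 + 1) / Real.sqrt n) := by
          refine lintegral_mono fun s => ?_
          gcongr
          exact lintegral_enorm_weightedMean_le μ hm hb h0 hgb hn s
      _ = _ := by
          rw [lintegral_mul_const' _ _ ENNReal.ofReal_ne_top, integral_cauchyWeight hb0,
            ← ENNReal.ofReal_mul (by positivity), mul_comm]
  have hsub : {ω | ∃ θ, b ≤ |θ - θstar| ∧ c * |θ - θstar| ^ 2 ≤
      |weightedMean n (fun i j => ξ i j ω) f θ - weightedMean n (fun i j => ξ i j ω) f θstar|} ⊆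
      {ω | ENNReal.ofReal (c / 2) ≤ T ω} := by
    rintro ω ⟨θ, hbθ, hcθ⟩
    change ENNReal.ofReal (c / 2) ≤ T ω
    set δ := |θ - θstar| with hδ
    have hδ0 : 0 < δ := hb0.trans_le hbθ
    rw [weightedMean_sub_eq_integral hlip, abs_neg, ← Real.norm_eq_abs,
      intervalIntegral.norm_integral_eq_norm_integral_uIoc] at hcθ
    have h1 : ENNReal.ofReal (c * δ ^ 2) ≤ ∫⁻ s in Set.uIoc θstar θ, ‖V s ω‖ₑ := by
      refine (ENNReal.ofReal_le_ofReal hcθ).trans ?_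
      rw [ofReal_norm]
      exact enorm_integral_le_lintegral_enorm _
    have h2 : ∫⁻ s in Set.uIoc θstar θ, ‖V s ω‖ₑ ≤ ENNReal.ofReal (2 * δ ^ 2) * T ω := by
      rw [hT, ← lintegral_const_mul' _ _ ENNReal.ofReal_ne_top]
      refine (setLIntegral_mono' measurableSet_uIoc fun s hs => ?_).trans
        (setLIntegral_le_lintegral (Set.uIoc θstar θ) _)
      rw [← mul_assoc, ← ENNReal.ofReal_mul (by positivity)]
      refine le_mul_of_one_le_left zero_le ?_
      rw [ENNReal.one_le_ofReal]
      have hsd : (s - θstar) ^ 2 ≤ δ ^ 2 := by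
        rw [sq_le_sq, abs_abs]
        exact Set.abs_sub_left_of_mem_uIcc (Set.uIoc_subset_uIcc hs)
      have hbd : b ^ 2 ≤ δ ^ 2 := pow_le_pow_left₀ hb0.le hbθ 2
      have e : 2 * δ ^ 2 * w s = 2 * δ ^ 2 / (b ^ 2 + (s - θstar) ^ 2) := by
        simp only [hw]
        field_simp
      rw [e, one_le_div (by positivity)]
      linarith
    have h3 := h1.trans h2
    have e : c * δ ^ 2 = 2 * δ ^ 2 * (c / 2) := by ring
    rw [e, ENNReal.ofReal_mul (by positivity)] at h3
    exact (ENNReal.mul_le_mul_iff_right (ENNReal.ofReal_pos.2 (by positivity)).ne'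
      ENNReal.ofReal_ne_top).1 h3
  refine (measure_mono hsub).trans ((meas_ge_le_lintegral_div hTm.aemeasurable
    (ENNReal.ofReal_pos.2 (by positivity)).ne' ENNReal.ofReal_ne_top).trans ?_)
  refine (ENNReal.div_le_div_right hET _).trans_eq ?_
  rw [← ENNReal.ofReal_div_of_pos (by positivity)]
  congr 1
  field_simp

/-! ### Order indicators: means and correlations -/

open Classical in
/-- The indicator of `y j ≤ y i`. -/
noncomputable def orderIndicator (y : ℕ → ℝ) (i j : ℕ) : ℝ := if y j ≤ y i then 1 else 0

theorem orderIndicator_nonneg (y : ℕ → ℝ) (i j : ℕ) : 0 ≤ orderIndicator y i j := by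
  rw [orderIndicator]; split_ifs <;> norm_num

theorem orderIndicator_le_one (y : ℕ → ℝ) (i j : ℕ) : orderIndicator y i j ≤ 1 := by
  rw [orderIndicator]; split_ifs <;> norm_num

theorem empiricalM_eq_weightedMean (f : ℝ → ℝ) (n : ℕ) (y : ℕ → ℝ) (θ : ℝ) :
    empiricalM f n y θ = weightedMean n (orderIndicator y) f θ := by
  simp only [empiricalM, weightedMean, rank, orderIndicator, Finset.card_filter, Nat.cast_sum,
    Nat.cast_ite, Nat.cast_one, Nat.cast_zero, one_div_mul_eq_div]

theorem weightedMean_sub_intCast {f : ℝ → ℝ} (hper : Function.Periodic f 1) (n : ℕ)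
    (A : ℕ → ℕ → ℝ) (θ : ℝ) (k : ℤ) : weightedMean n A f (θ - k) = weightedMean n A f θ := by
  simp only [weightedMean]
  congr 1
  refine Finset.sum_congr rfl fun i _ => ?_
  rw [← hper.sub_int_mul_eq (x := (i : ℝ) / n - (θ - k)) k]
  congr 2; ring

/-- The probability that `Y_j ≤ Y_i`, for regression values `a`. -/
noncomputable def orderProb (q : ℝ → ℝ) (a : ℕ → ℝ) (i j : ℕ) : ℝ :=
  if i = j then 1 else q (a i - a j)

theorem integral_orderIndicator {μ : Measure Ω} [IsProbabilityMeasure μ] {ν : Measure ℝ}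
    {Z : ℕ → Ω → ℝ} (hZ_meas : ∀ i, Measurable (Z i)) (hZ_indep : iIndepFun Z μ)
    (hZ_law : ∀ i, μ.map (Z i) = ν) (a : ℕ → ℝ) (i j : ℕ) :
    ∫ ω, orderIndicator (fun k => a k + Z k ω) i j ∂μ = orderProb (diffDistFun ν) a i j := by
  classical
  by_cases hij : i = j
  · simp [orderProb, orderIndicator, hij]
  have hset : MeasurableSet {ω | a j + Z j ω ≤ a i + Z i ω} :=
    measurableSet_le ((hZ_meas j).const_add _) ((hZ_meas i).const_add _)
  have h1 : ∀ ω, orderIndicator (fun k => a k + Z k ω) i j =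
      {ω | a j + Z j ω ≤ a i + Z i ω}.indicator (fun _ => (1 : ℝ)) ω := by
    intro ω
    simp [orderIndicator, Set.indicator_apply]
  simp_rw [h1]
  rw [integral_indicator_const _ hset, smul_eq_mul, mul_one, orderProb, if_neg hij, diffDistFun]
  have hlaw := (hZ_indep.indepFun hij).map_prod_eq_prod_map_map (hZ_meas i).aemeasurable
    (hZ_meas j).aemeasurable
  rw [hZ_law, hZ_law] at hlaw
  rw [← hlaw, measureReal_def, measureReal_def,
    Measure.map_apply ((hZ_meas i).prodMk (hZ_meas j)) (measurableSet_snd_le_fst_add _)]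
  congr 2
  ext ω
  simp only [Set.mem_ofPred_eq, Set.mem_preimage]
  constructor <;> intro h <;> linarith

theorem measurable_orderIndicator_add (a : ℕ → ℝ) (i j : ℕ) :
    Measurable fun z : ℝ × ℝ => (if a j + z.2 ≤ a i + z.1 then 1 else 0 : ℝ) :=
  Measurable.ite (measurableSet_le (by fun_prop) (by fun_prop)) measurable_const measurable_const

theorem orderIndicator_add_eq (a : ℕ → ℝ) (Z : ℕ → ℝ) (i j : ℕ) :
    orderIndicator (fun k => a k + Z k) i j = if a j + Z j ≤ a i + Z i then 1 else 0 := by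
  rw [orderIndicator]

theorem measurable_orderIndicator {Z : ℕ → Ω → ℝ} (hZ_meas : ∀ i, Measurable (Z i)) (a : ℕ → ℝ)
    (i j : ℕ) : Measurable fun ω => orderIndicator (fun k => a k + Z k ω) i j := by
  simp_rw [orderIndicator_add_eq]
  exact (measurable_orderIndicator_add a i j).comp ((hZ_meas i).prodMk (hZ_meas j))

/-- Disjoint index pairs involve independent noise pairs, so the expectation factors into two
vanishing means. The case i = j is covered since `orderProb` is then 1. -/
theorem integral_centred_mul_centred_eq_zero {μ : Measure Ω} [IsProbabilityMeasure μ]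
    {ν : Measure ℝ} {Z : ℕ → Ω → ℝ} (hZ_meas : ∀ i, Measurable (Z i)) (hZ_indep : iIndepFun Z μ)
    (hZ_law : ∀ i, μ.map (Z i) = ν) (a : ℕ → ℝ) (i j k l : ℕ)
    (hik : i ≠ k) (hil : i ≠ l) (hjk : j ≠ k) (hjl : j ≠ l) :
    ∫ ω, (orderIndicator (fun k => a k + Z k ω) i j - orderProb (diffDistFun ν) a i j) *
      (orderIndicator (fun k => a k + Z k ω) k l - orderProb (diffDistFun ν) a k l) ∂μ = 0 := by
  have hind := (hZ_indep.indepFun_prodMk_prodMk hZ_meas i j k l hik hil hjk hjl).comp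
    ((measurable_orderIndicator_add a i j).sub_const (orderProb (diffDistFun ν) a i j))
    ((measurable_orderIndicator_add a k l).sub_const (orderProb (diffDistFun ν) a k l))
  have hm : ∀ i j, Measurable fun ω =>
      orderIndicator (fun k => a k + Z k ω) i j - orderProb (diffDistFun ν) a i j :=
    fun i j => (measurable_orderIndicator hZ_meas a i j).sub_const _
  have hind' : IndepFun
      (fun ω => orderIndicator (fun k => a k + Z k ω) i j - orderProb (diffDistFun ν) a i j)
      (fun ω => orderIndicator (fun k => a k + Z k ω) k l - orderProb (diffDistFun ν) a k l) μ := by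
    simp_rw [orderIndicator_add_eq]
    exact hind
  rw [hind'.integral_fun_mul_eq_mul_integral (hm i j).aestronglyMeasurable
    (hm k l).aestronglyMeasurable]
  have hI : Integrable (fun ω => orderIndicator (fun k => a k + Z k ω) i j) μ := by
    refine Integrable.of_bound (measurable_orderIndicator hZ_meas a i j).aestronglyMeasurable 1
      (Filter.Eventually.of_forall fun ω => ?_)
    rw [Real.norm_eq_abs, abs_of_nonneg (orderIndicator_nonneg _ _ _)]
    exact orderIndicator_le_one _ _ _
  rw [integral_sub hI (integrable_const _), integral_const, probReal_univ, one_smul,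
    integral_orderIndicator hZ_meas hZ_indep hZ_law, sub_self, zero_mul]

end RankTemplate

/-! ### Conclusion -/

theorem mainTheorem2
    {Ω : Type*} [MeasurableSpace Ω] (μ : Measure Ω) [IsProbabilityMeasure μ]
    -- the template: Lipschitz and exactly 1-periodic
    (f : ℝ → ℝ) (θstar : ℝ)
    (hf_per : Function.Periodic f 1)
    (hf_exact : ∀ θ : ℝ, ¬ RankTemplate.EqModOne θ θstar →
      0 < volume {x : ℝ | x ∈ Set.Icc (0 : ℝ) 1 ∧ f (x - θ) ≠ f (x - θstar)})
    (hf_lip : ∃ L : NNReal, LipschitzWith L f)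
    -- the noise: iid with an even density
    (φ : ℝ → ℝ) (hφ_meas : Measurable φ) (hφ_nonneg : ∀ z, 0 ≤ φ z)
    (hφ_even : ∀ z, φ (-z) = φ z)
    (Z : ℕ → Ω → ℝ) (hZ_meas : ∀ i, Measurable (Z i)) (hZ_indep : iIndepFun Z μ)
    (hZ_law : ∀ i, μ.map (Z i) = volume.withDensity (fun z => ENNReal.ofReal (φ z)))
    -- the true shift is the unique maximum point of the limit objective, modulo 1
    (hM : ∀ θ : ℝ, ¬ RankTemplate.EqModOne θ θstar →
      RankTemplate.limitM f φ θstar θ < RankTemplate.limitM f φ θstar θstar)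
    -- the estimator: any maximizer of the rank objective
    (θhat : ℕ → Ω → ℝ)
    (hθhat : ∀ n : ℕ, 1 ≤ n → ∀ᵐ ω ∂μ, ∀ θ : ℝ,
      RankTemplate.empiricalM f n
          (RankTemplate.observation f θstar n (fun i => Z i ω)) θ ≤
        RankTemplate.empiricalM f n
          (RankTemplate.observation f θstar n (fun i => Z i ω)) (θhat n ω)) :
    RankTemplate.BoundedInProbability μ
      (fun n ω => Real.sqrt n * RankTemplate.circleDist (θhat n ω) θstar) := by
  open RankTemplate in
  obtain ⟨L₀, hlip₀⟩ := hf_lip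
  -- Enlarged to be positive, since the growth constants divide by L.
  set L : NNReal := L₀ + 1 with hL
  have hlip : LipschitzWith L f := hlip₀.weaken le_self_add
  have hLpos : 0 < L := by positivity
  set ν : Measure ℝ := volume.withDensity (fun z => ENNReal.ofReal (φ z)) with hν
  have : IsProbabilityMeasure ν := by
    rw [← hZ_law 0]
    exact Measure.isProbabilityMeasure_map (hZ_meas 0).aemeasurable
  obtain ⟨c, hc, r, hr, hgrow⟩ := exists_linear_growth_diffDistFun hφ_meas.ennreal_ofReal
  obtain ⟨c₁, hc₁, C, hC, hsep⟩ := exists_quadratic_separation hLpos hf_per hlip hf_exact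
    (diffDistFun_monotone ν) (diffDistFun_nonneg ν) (diffDistFun_le_one ν) hc hr hgrow
  intro ε hε
  set B : ℝ := (2 * (L : ℝ) ^ 2 + 1) * Real.pi * (4 / c₁) with hB
  have hB0 : 0 < B := by positivity
  -- B / K is the noise bound at b = K / √n, c = c₁ / 2; the second summand makes it at most ε. The
  -- first and third give K² ≥ 2C / c₁, so that C / n is absorbed by half the quadratic term.
  set K : ℝ := 1 + B / ε + 2 * C / c₁ with hK
  have hK1 : 1 ≤ K := by
    have : 0 < B / ε := by positivity
    have : 0 < 2 * C / c₁ := by positivity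
    linarith
  have hK0 : 0 < K := by linarith
  have hKC : 2 * C / c₁ ≤ K ^ 2 := by
    have : 0 < B / ε := by positivity
    nlinarith
  have hKB : B / K ≤ ε := by
    rw [div_le_iff₀ hK0, ← div_le_iff₀' hε]
    have : 0 < 2 * C / c₁ := by positivity
    linarith
  refine ⟨K, fun n => ?_⟩
  rcases Nat.eq_zero_or_pos n with rfl | hn
  · simp [not_lt.2 hK0.le]
  have hn0 : (0 : ℝ) < n := by exact_mod_cast hn
  have hsq : 0 < Real.sqrt n := Real.sqrt_pos.2 hn0
  have hsq2 : Real.sqrt n ^ 2 = n := Real.sq_sqrt hn0.le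
  set a : ℕ → ℝ := fun i => f ((i : ℝ) / n - θstar) with ha
  set q := diffDistFun ν with hq
  set ξ : ℕ → ℕ → Ω → ℝ := fun i j ω =>
    orderIndicator (fun k => a k + Z k ω) i j - orderProb q a i j with hξ
  have hp0 : ∀ i j, 0 ≤ orderProb q a i j := by
    intro i j
    rw [orderProb]
    split_ifs
    exacts [zero_le_one, diffDistFun_nonneg _ _]
  have hp1 : ∀ i j, orderProb q a i j ≤ 1 := by
    intro i j
    rw [orderProb]
    split_ifs
    exacts [le_rfl, diffDistFun_le_one _ _]
  have hnoise := measure_exists_weightedMean_sub_ge_le μ (ξ := ξ)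
    (fun i j => (measurable_orderIndicator hZ_meas a i j).sub_const _)
    (fun i j ω => by
      have h1 := orderIndicator_nonneg (fun k => a k + Z k ω) i j
      have h2 := orderIndicator_le_one (fun k => a k + Z k ω) i j
      rw [abs_le]
      constructor <;> simp only [hξ] <;> linarith [hp0 i j, hp1 i j])
    (integral_centred_mul_centred_eq_zero hZ_meas hZ_indep hZ_law a)
    hlip θstar hn.ne' (b := K / Real.sqrt n) (c := c₁ / 2) (by positivity) (by positivity)
  have hval : (2 * (L : ℝ) ^ 2 + 1) / Real.sqrt n * (Real.pi / (K / Real.sqrt n)) *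
      (2 / (c₁ / 2)) = B / K := by
    rw [hB]
    field_simp
    ring
  rw [hval] at hnoise
  refine le_trans (measure_mono_ae ?_) (hnoise.trans (ENNReal.ofReal_le_ofReal hKB))
  filter_upwards [hθhat n hn] with ω hmax hω
  change K < |Real.sqrt n * circleDist (θhat n ω) θstar| at hω
  set δ := circleDist (θhat n ω) θstar with hδ
  have hδ0 : 0 ≤ δ := circleDist_nonneg _ _
  rw [abs_of_nonneg (by positivity)] at hω
  obtain ⟨k, hk⟩ := exists_abs_eq_circleDist (θhat n ω) θstar
  -- The noise event lives on the line, so the representative of the maximizer nearest θ* is used;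
  -- the objective is unchanged by periodicity.
  refine ⟨θhat n ω - k, ?_, ?_⟩
  · rw [hk, div_le_iff₀ hsq]
    linarith
  rw [hk, weightedMean_sub_intCast hf_per]
  have hm := hmax θstar
  rw [empiricalM_eq_weightedMean, empiricalM_eq_weightedMean] at hm
  change weightedMean n (orderIndicator (fun k => a k + Z k ω)) f θstar ≤
    weightedMean n (orderIndicator (fun k => a k + Z k ω)) f (θhat n ω) at hm
  have hs := hsep n hn.ne' (θhat n ω)
  have hpm : ∀ θ, weightedMean n (fun i j => ξ i j ω) f θ =
      weightedMean n (orderIndicator (fun k => a k + Z k ω)) f θ -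
        weightedMean n (orderProb q a) f θ := fun θ => weightedMean_sub n _ _ f θ
  have hdiff : c₁ * δ ^ 2 - C / n ≤
      weightedMean n (orderProb q a) f θstar - weightedMean n (orderProb q a) f (θhat n ω) := by
    refine hs.trans_eq ?_
    simp only [weightedMean, orderProb]
    rw [← mul_sub, ← Finset.sum_sub_distrib]
    simp only [mul_sub, ha]
  have hCn : C / n ≤ c₁ / 2 * δ ^ 2 := by
    have h1 : K ^ 2 ≤ n * δ ^ 2 := by
      have := pow_le_pow_left₀ hK0.le hω.le 2
      rwa [mul_pow, hsq2] at this
    have h2 := hKC.trans h1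
    rw [div_le_iff₀ hc₁] at h2
    rw [div_le_iff₀ hn0]
    linarith
  rw [hpm, hpm]
  refine le_trans ?_ (le_abs_self _)
  linarith
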